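/- Let $N, W, L, M$ be positive integers and let $w = (w[0],\dots,w[W-1]) \in \mathbb{C}^W$ be a window, extended by $w[k] = 0$ for all integers $k \notin \{0,\dots,W-1\}$. For a signal $x = (x[0],\dots,x[N-1]) \in \mathbb{C}^N$ the short-time Fourier transform (STFT) with separation $L$ is $$Y_w^x[m,r] = \sum_{n=0}^{N-1} x[n]\, w[rL-n]\, e^{-2\pi i mn/N},$$ and $R = \lceil (N+W-1)/L \rceil$ is the number of short-time sections. The STFT magnitude of $x$ consists of the numbers $|Y_w^x[m,r]|$ for $1 \le m \le M$ and $0 \le r \le R-1$. A vector is called non-vanishing if all its entries are non-zero. Suppose that (i) $w$ is non-vanishing, (ii) $L < W \le N/2$, and (iii) $2W \le M \le N$. Then almost every non-vanishing signal is determined up to a global phase by its STFT magnitude: the set of non-vanishing $x \in \mathbb{C}^N$ for which there is a signal $y \in \mathbb{C}^N$ with $|Y_w^y[m,r]| = |Y_w^x[m,r]|$ for all $1 \le m \le M$, $0 \le r \le R-1$, but with $y \ne e^{i\phi} x$ for every $\phi \in \mathbb{R}$, has Lebesgue measure zero in $\mathbb{C}^N \cong \mathbb{R}^{2N}$. -/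

import Mathlib

namespace STFTPhase

/-- The window `w[0], …, w[W-1]`, extended by zero to all integer indices. -/
def windowAt {W : ℕ} (w : Fin W → ℂ) (k : ℤ) : ℂ :=
  if h : 0 ≤ k ∧ k < (W : ℤ) then w ⟨k.toNat, by omega⟩ else 0

/-- The STFT of `x` with window `w` and separation `L`:
`Y_w[m, r] = ∑_{n = 0}^{N - 1} x[n] w[r L - n] exp(- 2 π i m n / N)`. -/
noncomputable def stft {N W : ℕ} (w : Fin W → ℂ) (L : ℕ) (x : Fin N → ℂ) (m r : ℕ) : ℂ :=
  ∑ n : Fin N, x n * windowAt w ((r : ℤ) * (L : ℤ) - ((n : ℕ) : ℤ)) *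
    Complex.exp (-Complex.I * (2 * (Real.pi : ℂ)) * ((m : ℂ) * ((n : ℕ) : ℂ) / (N : ℂ)))

/-- The number `R = ⌈(N + W - 1) / L⌉` of short-time sections. -/
noncomputable def numSections (N W L : ℕ) : ℕ :=
  ⌈((N : ℝ) + (W : ℝ) - 1) / (L : ℝ)⌉₊

/-- A signal or window is non-vanishing if none of its entries is zero. -/
def NonVanishing {n : ℕ} (x : Fin n → ℂ) : Prop :=
  ∀ i, x i ≠ 0

/-- `x` and `y` have the same STFT magnitude measurements, i.e. the same `|Y_w[m, r]|` for
`1 ≤ m ≤ M` and `0 ≤ r ≤ R - 1`. -/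
def SameSTFTMagnitude {N W : ℕ} (w : Fin W → ℂ) (L M : ℕ) (x y : Fin N → ℂ) : Prop :=
  ∀ m r : ℕ, 1 ≤ m → m ≤ M → r < numSections N W L → ‖stft w L x m r‖ = ‖stft w L y m r‖

/-- `x` is determined up to a global phase by its STFT magnitude: every signal in `ℂ^N` with the
same STFT magnitude measurements is `e^{i φ} x` for some real `φ`. -/
def UniquelyIdentified {N W : ℕ} (w : Fin W → ℂ) (L M : ℕ) (x : Fin N → ℂ) : Prop :=
  ∀ y : Fin N → ℂ, SameSTFTMagnitude w L M x y →
    ∃ φ : ℝ, y = Complex.exp (Complex.I * (φ : ℂ)) • x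

end STFTPhase

/-!
The `r`-th section of the STFT is the discrete Fourier transform of the entries of `x` seen through
the shifted window. Its squared modulus is a trigonometric polynomial of degree less than `W`, so
`2 W` frequencies determine it, that is, they determine the autocorrelation `P * P⋆` of the
polynomial `P` whose coefficients are the entries of the section, where `P⋆` is the conjugate
reciprocal of `P` (`mul_conjReflect_eq_of_norm_eval_eq`).

If `Q * Q⋆ = P * P⋆`, then `Q` arises from `P` by reflecting a set `S` of roots of `P` in the unit
circle, up to a factor of modulus one (`exists_root_flip`). This multiplies the modulus of the
constant coefficient by `∏ i ∈ S, ‖a i‖⁻¹`, where the `a i` are the reflected roots. So if the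
modulus of the constant coefficient is known and no nonempty product of moduli of roots equals `1`,
then `Q` is `P` up to a phase (`eq_C_mul_of_mul_conjReflect_eq`). This condition on the roots holds
for almost every coefficient vector, because the exceptional vectors form the image of a null set
under the smooth map from roots to coefficients (`ae_isGenericCoeff`).

The section `r = 0` consists of the single entry `x[0]` and gives its modulus. Since `L < W`, each
later section starts at an entry that belongs to the part of the signal already recovered up to a
phase. The modulus of that entry is therefore known, and since `x` does not vanish there, the phase
of the new section agrees with the phase found before (`uniquelyIdentified_of_generic`).
-/

open Polynomial MeasureTheory

/-! ### Conjugate reciprocals and root flips -/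

/-- The conjugate reciprocal `X ^ d * conj (p (1 / conj X))` of `p`, regarded as a polynomial of
degree at most `d`. -/
noncomputable def conjReflect (d : ℕ) (p : ℂ[X]) : ℂ[X] :=
  reflect d (p.map (starRingEnd ℂ))

theorem natDegree_conjReflect_le {d : ℕ} {p : ℂ[X]} (hp : p.natDegree ≤ d) :
    (conjReflect d p).natDegree ≤ d :=
  natDegree_reflect_le.trans (max_le le_rfl (natDegree_map_le.trans hp))

theorem conjReflect_conjReflect (d : ℕ) (p : ℂ[X]) : conjReflect d (conjReflect d p) = p := by
  ext i
  simp [conjReflect]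

theorem conjReflect_mul {p q : ℂ[X]} {d e : ℕ} (hp : p.natDegree ≤ d) (hq : q.natDegree ≤ e) :
    conjReflect (d + e) (p * q) = conjReflect d p * conjReflect e q := by
  unfold conjReflect
  rw [Polynomial.map_mul]
  exact reflect_mul _ _ (natDegree_map_le.trans hp) (natDegree_map_le.trans hq)

theorem conjReflect_C (c : ℂ) : conjReflect 0 (C c) = C (starRingEnd ℂ c) := by
  simp [conjReflect]

theorem conjReflect_X_sub_C (a : ℂ) :
    conjReflect 1 (X - C a) = 1 - C (starRingEnd ℂ a) * X := by
  simp [conjReflect, reflect_sub]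

theorem eval_conjReflect {d : ℕ} {p : ℂ[X]} (hp : p.natDegree ≤ d) {ζ : ℂ} (hζ : ‖ζ‖ = 1) :
    (conjReflect d p).eval ζ = ζ ^ d * starRingEnd ℂ (p.eval ζ) := by
  have h1 : ζ * starRingEnd ℂ ζ = 1 := by
    rw [Complex.mul_conj, Complex.normSq_eq_norm_sq, hζ]; simp
  let _ : Invertible (starRingEnd ℂ ζ) := ⟨ζ, h1, by rw [mul_comm]; exact h1⟩
  have h := eval₂_reflect_mul_pow (RingHom.id ℂ) (starRingEnd ℂ ζ) d
    (p.map (starRingEnd ℂ)) (natDegree_map_le.trans hp)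
  have h2 : eval ζ (conjReflect d p) * (starRingEnd ℂ ζ) ^ d = starRingEnd ℂ (p.eval ζ) := by
    rw [← eval_map_apply (starRingEnd ℂ)]
    exact h
  rw [← h2, mul_left_comm, ← mul_pow, h1, one_pow, mul_one]

theorem eval_mul_conjReflect {d : ℕ} {p : ℂ[X]} (hp : p.natDegree ≤ d) {ζ : ℂ} (hζ : ‖ζ‖ = 1) :
    (p * conjReflect d p).eval ζ = ζ ^ d * (‖p.eval ζ‖ : ℂ) ^ 2 := by
  rw [eval_mul, eval_conjReflect hp hζ, mul_left_comm, Complex.mul_conj,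
    Complex.normSq_eq_norm_sq]
  push_cast
  rfl

/-- The values of `‖p‖` at more than `2 * d` points of the unit circle determine the
autocorrelation polynomial `p * conjReflect d p`, whose degree is at most `2 * d`. -/
theorem mul_conjReflect_eq_of_norm_eval_eq {d : ℕ} {p q : ℂ[X]} (hp : p.natDegree ≤ d)
    (hq : q.natDegree ≤ d) {s : Finset ℂ} (hs : 2 * d < s.card) (hs1 : ∀ ζ ∈ s, ‖ζ‖ = 1)
    (h : ∀ ζ ∈ s, ‖p.eval ζ‖ = ‖q.eval ζ‖) :
    p * conjReflect d p = q * conjReflect d q := by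
  have hdeg : ∀ f : ℂ[X], f.natDegree ≤ d → (f * conjReflect d f).degree < s.card := by
    intro f hf
    refine lt_of_le_of_lt degree_le_natDegree (Nat.cast_lt.2 (lt_of_le_of_lt ?_ hs))
    have := natDegree_conjReflect_le hf
    exact natDegree_mul_le.trans (by omega)
  refine eq_of_degrees_lt_of_eval_finset_eq s (hdeg p hp) (hdeg q hq) fun ζ hζ => ?_
  rw [eval_mul_conjReflect hp (hs1 ζ hζ), eval_mul_conjReflect hq (hs1 ζ hζ), h ζ hζ]

theorem natDegree_C_mul_prod_X_sub_C_le {ι : Type*} (c : ℂ) (a : ι → ℂ) (s : Finset ι) :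
    (C c * ∏ i ∈ s, (X - C (a i))).natDegree ≤ s.card := by
  refine (natDegree_C_mul_le _ _).trans ((natDegree_prod_le _ _).trans ?_)
  simp

theorem mul_conjReflect_C_mul_prod {ι : Type*} [DecidableEq ι] (c : ℂ) (a : ι → ℂ)
    (s : Finset ι) :
    (C c * ∏ i ∈ s, (X - C (a i))) * conjReflect s.card (C c * ∏ i ∈ s, (X - C (a i))) =
      C (c * starRingEnd ℂ c) *
        ∏ i ∈ s, ((X - C (a i)) * (1 - C (starRingEnd ℂ (a i)) * X)) := by
  induction s using Finset.induction_on with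
  | empty => simp [conjReflect_C]
  | insert j s hj ih =>
    have e : C c * ∏ i ∈ insert j s, (X - C (a i)) =
        (C c * ∏ i ∈ s, (X - C (a i))) * (X - C (a j)) := by
      rw [Finset.prod_insert hj]; ring
    rw [e, Finset.card_insert_of_notMem hj,
      conjReflect_mul (natDegree_C_mul_prod_X_sub_C_le c a s) (natDegree_X_sub_C_le _),
      conjReflect_X_sub_C, Finset.prod_insert hj, mul_left_comm (C (c * starRingEnd ℂ c)), ← ih]
    ring

/-- A polynomial with the same autocorrelation as `c * ∏ (X - a i)` arises from it by reflecting
some of the roots in the unit circle, up to a factor of modulus one. -/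
theorem exists_root_flip {ι : Type*} [DecidableEq ι] (c : ℂ) (a : ι → ℂ) (s : Finset ι)
    (q : ℂ[X]) (hq : q.natDegree ≤ s.card)
    (h : q * conjReflect s.card q = C (c * starRingEnd ℂ c) *
      ∏ i ∈ s, ((X - C (a i)) * (1 - C (starRingEnd ℂ (a i)) * X))) :
    ∃ (u : ℂ) (S : Finset ι), ‖u‖ = ‖c‖ ∧
      q = C u * ∏ i ∈ s, if i ∈ S then 1 - C (starRingEnd ℂ (a i)) * X else X - C (a i) := by
  induction s using Finset.induction_on generalizing q with
  | empty =>
    rw [Finset.card_empty] at hq h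
    obtain ⟨u, rfl⟩ : ∃ u, q = C u := ⟨_, eq_C_of_natDegree_le_zero hq⟩
    refine ⟨u, ∅, ?_, by simp⟩
    rw [conjReflect_C, Finset.prod_empty, mul_one, ← C_mul, C_inj, Complex.mul_conj,
      Complex.mul_conj, Complex.ofReal_inj, Complex.normSq_eq_norm_sq,
      Complex.normSq_eq_norm_sq] at h
    exact (pow_left_inj₀ (norm_nonneg _) (norm_nonneg _) two_ne_zero).1 h
  | insert j s hj ih =>
    rw [Finset.card_insert_of_notMem hj] at hq h
    rw [Finset.prod_insert hj] at h
    have hne : (X - C (a j)) * (1 - C (starRingEnd ℂ (a j)) * X) ≠ 0 := by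
      refine mul_ne_zero (X_sub_C_ne_zero _) fun h0 => ?_
      have := congrArg (eval 0) h0
      simp at this
    -- Dividing out the linear factor of `a j` leaves a cofactor of degree at most `#s`.
    have hdeg : ∀ f : ℂ[X], ((X - C (a j)) * f).natDegree ≤ s.card + 1 →
        f.natDegree ≤ s.card := by
      intro f hf
      rcases eq_or_ne f 0 with rfl | hf0
      · simp
      · rw [natDegree_mul (X_sub_C_ne_zero _) hf0, natDegree_X_sub_C] at hf
        omega
    have hdvd : X - C (a j) ∣ q * conjReflect (s.card + 1) q := by
      rw [h, mul_assoc, mul_left_comm]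
      exact dvd_mul_right _ _
    have hswap : ∀ f : ℂ[X], f.natDegree ≤ s.card →
        conjReflect (s.card + 1) ((X - C (a j)) * f) =
          (1 - C (starRingEnd ℂ (a j)) * X) * conjReflect s.card f := by
      intro f hf
      rw [add_comm, conjReflect_mul (natDegree_X_sub_C_le _) hf, conjReflect_X_sub_C]
    rcases (prime_X_sub_C (a j)).dvd_or_dvd hdvd with ⟨f, hf⟩ | ⟨f, hf⟩
    · have hfd := hdeg f (hf ▸ hq)
      obtain ⟨u, S, hu, hS⟩ := ih f hfd (mul_left_cancel₀ hne (by
        rw [hf, hswap f hfd] at h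
        linear_combination h))
      refine ⟨u, S.erase j, hu, ?_⟩
      rw [Finset.prod_insert hj, if_neg (Finset.notMem_erase j S), hf, hS, mul_left_comm]
      congr 2
      refine Finset.prod_congr rfl fun i hi => ?_
      have : i ≠ j := fun e => hj (e ▸ hi)
      simp [this]
    · have hfd := hdeg f (hf ▸ natDegree_conjReflect_le hq)
      have hq' : q = (1 - C (starRingEnd ℂ (a j)) * X) * conjReflect s.card f := by
        rw [← hswap f hfd, ← hf, conjReflect_conjReflect]
      obtain ⟨u, S, hu, hS⟩ := ih (conjReflect s.card f) (natDegree_conjReflect_le hfd)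
        (mul_left_cancel₀ hne (by
          rw [hf] at h
          nth_rw 1 [hq'] at h
          rw [conjReflect_conjReflect]
          linear_combination h))
      refine ⟨u, insert j S, hu, ?_⟩
      rw [Finset.prod_insert hj, if_pos (Finset.mem_insert_self j S), hq', hS, mul_left_comm]
      congr 2
      refine Finset.prod_congr rfl fun i hi => ?_
      have : i ≠ j := fun e => hj (e ▸ hi)
      simp [this]

/-- If no nonempty subproduct of the moduli of the roots of `p` equals `1`, then reflecting roots
in the unit circle changes the modulus of the constant coefficient, so that `p` is determined up
to a phase by its autocorrelation and `‖p.coeff 0‖`. -/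
theorem eq_C_mul_of_mul_conjReflect_eq {ι : Type*} [DecidableEq ι] {c : ℂ} {a : ι → ℂ}
    {s : Finset ι} (ha : ∀ S ⊆ s, S.Nonempty → ∏ i ∈ S, ‖a i‖ ≠ 1) {p q : ℂ[X]}
    (hp : p = C c * ∏ i ∈ s, (X - C (a i))) (hp0 : p.coeff 0 ≠ 0)
    (hq : q.natDegree ≤ s.card) (h0 : ‖q.coeff 0‖ = ‖p.coeff 0‖)
    (h : q * conjReflect s.card q = p * conjReflect s.card p) :
    ∃ u : ℂ, ‖u‖ = 1 ∧ q = C u * p := by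
  rw [hp, mul_conjReflect_C_mul_prod] at h
  obtain ⟨u, S, hu, hS⟩ := exists_root_flip c a s q hq h
  have hpc : p.coeff 0 = c * ∏ i ∈ s, -a i := by
    rw [coeff_zero_eq_eval_zero, hp]
    simp [eval_prod]
  have hqc : q.coeff 0 = u * ∏ i ∈ s, if i ∈ S then 1 else -a i := by
    rw [coeff_zero_eq_eval_zero, hS, eval_mul, eval_C, eval_prod]
    congr 1
    refine Finset.prod_congr rfl fun i _ => ?_
    split_ifs <;> simp
  have hc : c ≠ 0 := by
    rintro rfl
    simp [hpc] at hp0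
  have hne : ∏ i ∈ s with i ∉ S, ‖a i‖ ≠ 0 := by
    refine Finset.prod_ne_zero_iff.2 fun i hi h => hp0 ?_
    rw [hpc, Finset.prod_eq_zero (Finset.mem_filter.1 hi).1 (by simpa using h), mul_zero]
  have hprod : ∏ i ∈ s with i ∈ S, ‖a i‖ = 1 := by
    rw [hpc, hqc, norm_mul, norm_mul, hu, norm_prod, norm_prod] at h0
    have h1 := mul_left_cancel₀ (norm_ne_zero_iff.2 hc) h0
    simp only [apply_ite norm, norm_one, norm_neg] at h1
    rw [Finset.prod_ite, Finset.prod_const_one, one_mul,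
      ← Finset.prod_filter_mul_prod_filter_not s (· ∈ S)] at h1
    exact mul_right_cancel₀ hne (by rw [one_mul]; exact h1.symm)
  have hempty : ∀ i ∈ s, i ∉ S := fun i hi hiS =>
    ha _ (Finset.filter_subset _ s) ⟨i, Finset.mem_filter.2 ⟨hi, hiS⟩⟩ hprod
  refine ⟨u / c, by rw [norm_div, hu, div_self (norm_ne_zero_iff.2 hc)], ?_⟩
  rw [hp, ← mul_assoc, ← C_mul, div_mul_cancel₀ _ hc, hS]
  congr 1
  exact Finset.prod_congr rfl fun i hi => if_neg (hempty i hi)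

/-! ### Generic coefficient vectors -/

/-- The polynomial of degree at most `d` with coefficients `z 0, …, z d`. -/
noncomputable def coeffPoly {d : ℕ} (z : Fin (d + 1) → ℂ) : ℂ[X] :=
  ∑ i : Fin (d + 1), C (z i) * X ^ (i : ℕ)

theorem coeff_coeffPoly {d : ℕ} (z : Fin (d + 1) → ℂ) (i : Fin (d + 1)) :
    (coeffPoly z).coeff i = z i := by
  simp [coeffPoly, coeff_X_pow, Fin.val_inj]

theorem natDegree_coeffPoly_le {d : ℕ} (z : Fin (d + 1) → ℂ) : (coeffPoly z).natDegree ≤ d :=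
  natDegree_sum_le_of_forall_le _ _ fun i _ =>
    (natDegree_C_mul_X_pow_le _ _).trans (Nat.lt_succ_iff.1 i.2)

theorem eval_coeffPoly {d : ℕ} (z : Fin (d + 1) → ℂ) (t : ℂ) :
    (coeffPoly z).eval t = ∑ i : Fin (d + 1), z i * t ^ (i : ℕ) := by
  simp [coeffPoly, eval_finsetSum]

theorem eval_coeffPoly_zero (z : Fin (0 + 1) → ℂ) (t : ℂ) : (coeffPoly z).eval t = z 0 := by
  simp [eval_coeffPoly]

/-- The polynomial with leading coefficient `v 0` and roots `v 1, …, v d`. -/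
noncomputable def rootPoly {d : ℕ} (v : Fin (d + 1) → ℂ) : ℂ[X] :=
  C (v 0) * ∏ i : Fin d, (X - C (v i.succ))

/-- A coefficient vector is generic if no nonempty subproduct of the moduli of the roots of its
polynomial equals `1`. -/
def IsGenericCoeff {d : ℕ} (z : Fin (d + 1) → ℂ) : Prop :=
  ∀ v : Fin (d + 1) → ℂ, coeffPoly z = rootPoly v →
    ∀ S : Finset (Fin d), S.Nonempty → ∏ i ∈ S, ‖v i.succ‖ ≠ 1

theorem List.exists_ofFn_eq {α : Type*} {n : ℕ} (l : List α) (hl : l.length = n) :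
    ∃ r : Fin n → α, List.ofFn r = l := by
  subst hl
  exact ⟨l.get, List.ofFn_get l⟩

theorem exists_coeffPoly_eq_rootPoly {d : ℕ} (z : Fin (d + 1) → ℂ) (hz : z (Fin.last d) ≠ 0) :
    ∃ v : Fin (d + 1) → ℂ, coeffPoly z = rootPoly v := by
  have hlast : (coeffPoly z).coeff d = z (Fin.last d) := coeff_coeffPoly z (Fin.last d)
  have hdeg : (coeffPoly z).natDegree = d :=
    le_antisymm (natDegree_coeffPoly_le z) (le_natDegree_of_ne_zero (by rwa [hlast]))
  have hsplit := IsAlgClosed.splits (coeffPoly z)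
  obtain ⟨r, hr⟩ := (coeffPoly z).roots.toList.exists_ofFn_eq (n := d) (by
    rw [Multiset.length_toList, ← hsplit.natDegree_eq_card_roots, hdeg])
  refine ⟨Fin.cons (z (Fin.last d)) r, ?_⟩
  have h := hsplit.eq_prod_roots
  rw [leadingCoeff, hdeg, hlast, ← Multiset.coe_toList (coeffPoly z).roots, ← hr,
    Multiset.map_coe, Multiset.prod_coe, List.map_ofFn, List.prod_ofFn] at h
  exact h

/-- The vector of a generic `z` is determined up to a phase by the modulus of its first entry and
the moduli of its polynomial at more than `2 * d` points of the unit circle. -/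
theorem IsGenericCoeff.eq_smul {d : ℕ} {z z' : Fin (d + 1) → ℂ} (hz : IsGenericCoeff z)
    (hz0 : z 0 ≠ 0) (hzd : z (Fin.last d) ≠ 0) (h0 : ‖z' 0‖ = ‖z 0‖) {s : Finset ℂ}
    (hs : 2 * d < s.card) (hs1 : ∀ ζ ∈ s, ‖ζ‖ = 1)
    (h : ∀ ζ ∈ s, ‖(coeffPoly z').eval ζ‖ = ‖(coeffPoly z).eval ζ‖) :
    ∃ u : ℂ, ‖u‖ = 1 ∧ ∀ i, z' i = u * z i := by
  obtain ⟨v, hv⟩ := exists_coeffPoly_eq_rootPoly z hzd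
  have hcard : (Finset.univ : Finset (Fin d)).card = d := Finset.card_fin d
  have e (y : Fin (d + 1) → ℂ) : (coeffPoly y).coeff 0 = y 0 := coeff_coeffPoly y 0
  obtain ⟨u, hu, hq⟩ := eq_C_mul_of_mul_conjReflect_eq (s := Finset.univ)
    (fun S _ hS => hz v hv S hS) (q := coeffPoly z') hv (by rwa [e])
    (by rw [hcard]; exact natDegree_coeffPoly_le z') (by rwa [e, e])
    (by
      rw [hcard]
      exact mul_conjReflect_eq_of_norm_eval_eq (natDegree_coeffPoly_le z')
        (natDegree_coeffPoly_le z) hs hs1 h)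
  refine ⟨u, hu, fun i => ?_⟩
  rw [← coeff_coeffPoly z', hq, coeff_C_mul, coeff_coeffPoly]

theorem volume_prod_norm_eq_one {d : ℕ} (S : Finset (Fin d)) (hS : S.Nonempty) :
    volume {v : Fin (d + 1) → ℂ | ∏ i ∈ S, ‖v i.succ‖ = 1} = 0 := by
  obtain ⟨j, hj⟩ := hS
  have hmp := volume_preserving_piFinSuccAbove (fun _ : Fin (d + 1) => ℂ) j.succ
  have hmeas : MeasurableSet {v : Fin (d + 1) → ℂ | ∏ i ∈ S, ‖v i.succ‖ = 1} :=
    (isClosed_eq (by fun_prop) continuous_const).measurableSet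
  rw [← hmp.symm.measure_preimage hmeas.nullMeasurableSet, Measure.volume_eq_prod,
    Measure.prod_apply_symm (hmp.symm.measurable hmeas)]
  -- With the other coordinates fixed, the `j`-th root lies on a circle.
  refine lintegral_eq_zero_of_ae_eq_zero (ae_of_all _ fun y => ?_)
  refine measure_mono_null (fun x hx => ?_) (Measure.addHaar_sphere volume (0 : ℂ)
    (∏ i ∈ S.erase j, ‖(j.succ.insertNth 0 y : Fin (d + 1) → ℂ) i.succ‖)⁻¹)
  have hx' : ∏ i ∈ S, ‖(j.succ.insertNth x y : Fin (d + 1) → ℂ) i.succ‖ = 1 := hx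
  rw [← Finset.mul_prod_erase S _ hj, Fin.insertNth_apply_same] at hx'
  rw [mem_sphere_zero_iff_norm]
  refine eq_inv_of_mul_eq_one_left (Eq.trans ?_ hx')
  congr 1
  refine Finset.prod_congr rfl fun i hi => ?_
  obtain ⟨k, hk⟩ := Fin.exists_succAbove_eq (x := i.succ) (y := j.succ)
    fun e => Finset.ne_of_mem_erase hi (Fin.succ_injective _ e)
  rw [← hk, Fin.insertNth_apply_succAbove, Fin.insertNth_apply_succAbove]

theorem differentiable_coeff_prod {E ι : Type*} [NormedAddCommGroup E] [NormedSpace ℝ E]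
    {p : ι → E → ℂ[X]} (s : Finset ι)
    (hp : ∀ i ∈ s, ∀ k, Differentiable ℝ fun v => (p i v).coeff k) (k : ℕ) :
    Differentiable ℝ fun v => (∏ i ∈ s, p i v).coeff k := by
  classical
  induction s using Finset.induction_on generalizing k with
  | empty => simp
  | insert j s hj ih =>
    simp only [Finset.prod_insert hj, coeff_mul]
    refine Differentiable.fun_sum fun n _ => Differentiable.mul ?_ ?_
    · exact hp j (Finset.mem_insert_self j s) _
    · exact ih (fun i hi => hp i (Finset.mem_insert_of_mem hi)) _

theorem differentiable_rootPoly_coeff {d : ℕ} (k : ℕ) :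
    Differentiable ℝ fun v : Fin (d + 1) → ℂ => (rootPoly v).coeff k := by
  simp only [rootPoly, coeff_C_mul]
  refine Differentiable.mul (by fun_prop) (differentiable_coeff_prod _ (fun i _ n => ?_) k)
  simp only [coeff_sub, coeff_C]
  split_ifs <;> fun_prop

/-- The vectors that are not generic form the image, under the smooth map from roots to
coefficients, of the null set of root vectors with a subproduct of modulus `1`. -/
theorem ae_isGenericCoeff (d : ℕ) : ∀ᵐ z : Fin (d + 1) → ℂ, IsGenericCoeff z := by
  have hnull : volume (⋃ S : {S : Finset (Fin d) // S.Nonempty},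
      {v : Fin (d + 1) → ℂ | ∏ i ∈ S.1, ‖v i.succ‖ = 1}) = 0 :=
    measure_iUnion_null fun S => volume_prod_norm_eq_one S.1 S.2
  have hdiff : Differentiable ℝ fun (v : Fin (d + 1) → ℂ) (i : Fin (d + 1)) =>
      (rootPoly v).coeff i :=
    differentiable_pi.2 fun i => differentiable_rootPoly_coeff i
  refine measure_mono_null (fun z hz => ?_)
    (addHaar_image_eq_zero_of_differentiableOn_of_addHaar_eq_zero volume
      hdiff.differentiableOn hnull)
  simp only [IsGenericCoeff, Set.mem_compl_iff, Set.mem_ofPred_eq, not_forall, not_not] at hz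
  obtain ⟨v, hv, S, hS, h⟩ := hz
  refine ⟨v, Set.mem_iUnion.2 ⟨⟨S, hS⟩, h⟩, ?_⟩
  funext i
  rw [← coeff_coeffPoly z i, hv]

/-- Genericity may be tested on consecutive entries rescaled by nonzero factors. -/
theorem ae_isGenericCoeff_comp {N d : ℕ} {e : Fin (d + 1) → Fin N} (he : Function.Injective e)
    {c : Fin (d + 1) → ℂ} (hc : ∀ i, c i ≠ 0) :
    ∀ᵐ x : Fin N → ℂ, IsGenericCoeff fun i => x (e i) * c i := by
  let T : (Fin N → ℂ) →ₗ[ℝ] (Fin (d + 1) → ℂ) :=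
    { toFun := fun x i => x (e i) * c i
      map_add' := fun x y => funext fun i => add_mul _ _ _
      map_smul' := fun r x => funext fun i => by simp [mul_assoc] }
  have hT : Function.Surjective T := by
    intro z
    refine ⟨Function.extend e (fun i => z i / c i) 0, funext fun i => ?_⟩
    change Function.extend e (fun i => z i / c i) 0 (e i) * c i = z i
    rw [he.extend_apply, div_mul_cancel₀ _ (hc i)]
  obtain ⟨k, -, hk⟩ := T.exists_map_addHaar_eq_smul_addHaar volume volume hT
  have hTm : Measurable T := (LinearMap.continuous_of_finiteDimensional T).measurable
  have := ae_of_ae_map (μ := volume) (f := T) (p := IsGenericCoeff) hTm.aemeasurable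
    (by rw [hk]; exact Measure.ae_smul_measure (ae_isGenericCoeff d) k)
  exact this

/-! ### Sections of the short-time Fourier transform -/

theorem STFTPhase.windowAt_ne_zero_iff {W : ℕ} {w : Fin W → ℂ} (hw : STFTPhase.NonVanishing w)
    (k : ℤ) : STFTPhase.windowAt w k ≠ 0 ↔ 0 ≤ k ∧ k < W := by
  unfold STFTPhase.windowAt
  split_ifs with h
  · exact iff_of_true (hw _) h
  · exact iff_of_false (fun h0 => h0 rfl) h

theorem STFTPhase.lt_numSections_iff {N W L r : ℕ} (hL : 0 < L) :
    r < STFTPhase.numSections N W L ↔ r * L + 1 < N + W := by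
  have hL' : (0 : ℝ) < L := Nat.cast_pos.2 hL
  rw [STFTPhase.numSections, Nat.lt_ceil, lt_div_iff₀ hL', lt_sub_iff_add_lt]
  norm_cast

/-- The primitive `N`-th root of unity `exp (-2 π i / N)` of the discrete Fourier transform. -/
noncomputable def dftRoot (N : ℕ) : ℂ :=
  (Complex.exp (2 * Real.pi * Complex.I / N))⁻¹

theorem isPrimitiveRoot_dftRoot {N : ℕ} (hN : N ≠ 0) : IsPrimitiveRoot (dftRoot N) N :=
  (Complex.isPrimitiveRoot_exp N hN).inv

theorem exp_eq_dftRoot_pow (N m n : ℕ) :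
    Complex.exp (-Complex.I * (2 * (Real.pi : ℂ)) * ((m : ℂ) * (n : ℂ) / (N : ℂ))) =
      (dftRoot N ^ m) ^ n := by
  rw [dftRoot, ← Complex.exp_neg, ← Complex.exp_nat_mul, ← Complex.exp_nat_mul]
  congr 1
  ring

/-- The frequencies `m = 1, …, M` as points of the unit circle. -/
noncomputable def frequencies (N M : ℕ) : Finset ℂ :=
  (Finset.range M).image fun k => dftRoot N ^ (k + 1)

theorem card_frequencies {N M : ℕ} (hMN : M ≤ N) : (frequencies N M).card = M := by
  rw [frequencies, Finset.card_image_of_injOn, Finset.card_range]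
  intro k hk l hl h
  have hk' : k < M := Finset.mem_range.1 hk
  have hl' : l < M := Finset.mem_range.1 hl
  have hprim := isPrimitiveRoot_dftRoot (N := N) (by omega)
  have h' : dftRoot N ^ (k + 1) = dftRoot N ^ (l + 1) := h
  rw [pow_succ, pow_succ] at h'
  exact hprim.pow_inj (by omega) (by omega)
    (mul_right_cancel₀ (hprim.ne_zero (by omega)) h')

theorem norm_dftRoot_pow {N : ℕ} (hN : N ≠ 0) (m : ℕ) : ‖dftRoot N ^ m‖ = 1 := by
  rw [norm_pow, (isPrimitiveRoot_dftRoot hN).norm'_eq_one hN, one_pow]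

/-- The `r`-th short-time section sees exactly the entries `a, …, a + d` of a signal of length
`N`. -/
def IsSectionSupport {W : ℕ} (N : ℕ) (w : Fin W → ℂ) (L r a d : ℕ) : Prop :=
  ∀ n < N, STFTPhase.windowAt w ((r : ℤ) * (L : ℤ) - (n : ℤ)) ≠ 0 ↔ a ≤ n ∧ n ≤ a + d

/-- The entries `x n * w (r L - n)` for `a ≤ n ≤ a + d`; under `IsSectionSupport N w L r a d`
these are all the entries of the `r`-th short-time section that the window does not annihilate. -/
noncomputable def sectionCoeff {N W : ℕ} (w : Fin W → ℂ) (L r a d : ℕ) (had : a + d < N)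
    (x : Fin N → ℂ) (i : Fin (d + 1)) : ℂ :=
  x ⟨a + i, by omega⟩ *
    STFTPhase.windowAt w ((r : ℤ) * (L : ℤ) - ((a + (i : ℕ) : ℕ) : ℤ))

theorem norm_stft_eq {N W : ℕ} {w : Fin W → ℂ} {L r a d : ℕ} (had : a + d < N)
    (hwin : IsSectionSupport N w L r a d) (x : Fin N → ℂ) (m : ℕ) :
    ‖STFTPhase.stft w L x m r‖ =
      ‖(coeffPoly (sectionCoeff w L r a d had x)).eval (dftRoot N ^ m)‖ := by
  have h : STFTPhase.stft w L x m r =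
      (dftRoot N ^ m) ^ a *
        (coeffPoly (sectionCoeff w L r a d had x)).eval (dftRoot N ^ m) := by
    rw [eval_coeffPoly, Finset.mul_sum, STFTPhase.stft]
    symm
    refine Fintype.sum_of_injective (fun i : Fin (d + 1) => (⟨a + i, by omega⟩ : Fin N))
      (fun i j hij => ?_) _ _ (fun n hn => ?_) fun i => ?_
    · simpa [Fin.val_inj] using hij
    · rw [not_not.1 (mt (hwin n n.2).1 fun hn' => hn ⟨⟨n - a, by omega⟩, ?_⟩), mul_zero, zero_mul]
      exact Fin.ext (Nat.add_sub_of_le hn'.1)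
    · simp only [exp_eq_dftRoot_pow, sectionCoeff]
      rw [pow_add]
      ring
  rw [h, norm_mul, norm_pow, norm_dftRoot_pow (by omega), one_pow, one_mul]

/-- The magnitudes of one generic section determine its entries up to a phase, once the modulus
of the first entry is known. -/
theorem eq_mul_on_section {N W : ℕ} {w : Fin W → ℂ} {L M r a d : ℕ} (had : a + d < N)
    (hwin : IsSectionSupport N w L r a d) (hM : 2 * d < M) (hMN : M ≤ N) {x y : Fin N → ℂ}
    (hx : STFTPhase.NonVanishing x) (hgen : IsGenericCoeff (sectionCoeff w L r a d had x))
    (h0 : ‖y ⟨a, by omega⟩‖ = ‖x ⟨a, by omega⟩‖)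
    (h : ∀ m, 1 ≤ m → m ≤ M → ‖STFTPhase.stft w L x m r‖ = ‖STFTPhase.stft w L y m r‖) :
    ∃ u : ℂ, ‖u‖ = 1 ∧ ∀ n : Fin N, a ≤ n → (n : ℕ) ≤ a + d → y n = u * x n := by
  have hw' (i : Fin (d + 1)) :
      STFTPhase.windowAt w ((r : ℤ) * (L : ℤ) - ((a + (i : ℕ) : ℕ) : ℤ)) ≠ 0 :=
    (hwin (a + i) (by omega)).2 ⟨by omega, by omega⟩
  have hne (i : Fin (d + 1)) : sectionCoeff w L r a d had x i ≠ 0 := mul_ne_zero (hx _) (hw' i)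
  obtain ⟨u, hu, hy⟩ := hgen.eq_smul (z' := sectionCoeff w L r a d had y)
    (hne 0) (hne _) (by
      rw [sectionCoeff, sectionCoeff, norm_mul, norm_mul]
      exact congrArg (· * _) h0)
    (s := frequencies N M) (by rwa [card_frequencies hMN])
    (by
      intro ζ hζ
      obtain ⟨k, -, rfl⟩ := Finset.mem_image.1 hζ
      exact norm_dftRoot_pow (by omega) _)
    (by
      intro ζ hζ
      obtain ⟨k, hk, rfl⟩ := Finset.mem_image.1 hζ
      rw [← norm_stft_eq had hwin, ← norm_stft_eq had hwin]
      exact (h (k + 1) (by omega) (Finset.mem_range.1 hk)).symm)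
  refine ⟨u, hu, fun n han hnd => ?_⟩
  have hi := hy ⟨n - a, by omega⟩
  rw [sectionCoeff, sectionCoeff, ← mul_assoc] at hi
  have hn : (⟨a + (n - a), by omega⟩ : Fin N) = n := Fin.ext (Nat.add_sub_of_le han)
  simpa only [hn] using mul_right_cancel₀ (hw' ⟨n - a, by omega⟩) hi

/-- The support of the `r`-th section is the interval from `max 0 (r L - W + 1)` to
`min (r L) (N - 1)`; the maximum is expressed by truncated subtraction. -/
theorem isSectionSupport {N W L r : ℕ} {w : Fin W → ℂ} (hw : STFTPhase.NonVanishing w)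
    (hr : r * L + 1 < N + W) (hW : 0 < W) :
    IsSectionSupport N w L r (r * L + 1 - W)
      (min (r * L) (N - 1) - (r * L + 1 - W)) := by
  intro n hn
  rw [STFTPhase.windowAt_ne_zero_iff hw, ← Nat.cast_mul]
  generalize r * L = q at *
  omega

/-! ### Chaining the sections -/

/-- Every section starts inside the part of the signal covered by the preceding sections, so its
phase is the one already found there. -/
theorem uniquelyIdentified_of_generic {N W L M : ℕ} {w : Fin W → ℂ}
    (hw : STFTPhase.NonVanishing w) (hL : 0 < L) (hLW : L < W) (hN : 0 < N) (hWM : 2 * W ≤ M)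
    (hMN : M ≤ N) {x : Fin N → ℂ} (hx : STFTPhase.NonVanishing x)
    (hgen : ∀ (r a d : ℕ) (had : a + d < N),
      IsSectionSupport N w L r a d →
      IsGenericCoeff (sectionCoeff w L r a d had x)) :
    STFTPhase.UniquelyIdentified w L M x := by
  intro y hxy
  have hstep : ∀ r, r * L + 1 < N + W →
      ∃ u : ℂ, ‖u‖ = 1 ∧ ∀ n : Fin N, (n : ℕ) ≤ r * L → y n = u * x n := by
    intro r
    induction r with
    | zero =>
      intro hr
      have hwin := isSectionSupport hw hr (by omega)
      have hd : min (0 * L) (N - 1) - (0 * L + 1 - W) = 0 := by simp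
      have ha : 0 * L + 1 - W = 0 := by rw [zero_mul]; omega
      rw [hd, ha] at hwin
      have hmag (m : ℕ) (hm : 1 ≤ m) (hmM : m ≤ M) :=
        hxy m 0 hm hmM ((STFTPhase.lt_numSections_iff hL).2 hr)
      have h0 : ‖y ⟨0, hN⟩‖ = ‖x ⟨0, hN⟩‖ := by
        have h1 := hmag 1 le_rfl (by omega)
        rw [norm_stft_eq hN hwin, norm_stft_eq hN hwin, eval_coeffPoly_zero,
          eval_coeffPoly_zero, sectionCoeff, sectionCoeff, norm_mul, norm_mul] at h1
        exact (mul_right_cancel₀ (norm_ne_zero_iff.2 ((hwin 0 hN).2 ⟨le_rfl, le_rfl⟩)) h1).symm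
      obtain ⟨u, hu, hy⟩ := eq_mul_on_section hN hwin (by omega) hMN hx (hgen 0 0 0 hN hwin) h0 hmag
      exact ⟨u, hu, fun n hn => hy n (Nat.zero_le _) (by omega)⟩
    | succ r ih =>
      intro hr
      have hsucc : (r + 1) * L = r * L + L := Nat.succ_mul r L
      obtain ⟨u, hu, hy⟩ := ih (by omega)
      have hwin := isSectionSupport hw hr (by omega)
      have hmag (m : ℕ) (hm : 1 ≤ m) (hmM : m ≤ M) :=
        hxy m (r + 1) hm hmM ((STFTPhase.lt_numSections_iff hL).2 hr)
      have had : ((r + 1) * L + 1 - W) +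
          (min ((r + 1) * L) (N - 1) - ((r + 1) * L + 1 - W)) < N := by omega
      have hya := hy ⟨(r + 1) * L + 1 - W, by omega⟩
        (show (r + 1) * L + 1 - W ≤ r * L by omega)
      obtain ⟨v, -, hy'⟩ := eq_mul_on_section had hwin (by omega) hMN hx
        (hgen _ _ _ had hwin) (by rw [hya, norm_mul, hu, one_mul]) hmag
      have huv : v = u := by
        have hya' := hy' ⟨(r + 1) * L + 1 - W, by omega⟩ le_rfl (Nat.le_add_right _ _)
        exact mul_right_cancel₀ (hx _) (hya'.symm.trans hya)
      refine ⟨u, hu, fun n hn => ?_⟩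
      rcases le_total (n : ℕ) (r * L) with hnr | hnr
      · exact hy n hnr
      · rw [← huv]
        exact hy' n (by omega) (by omega)
  -- The last section reaches the end of the signal.
  obtain ⟨r, hr, hrN⟩ : ∃ r, r * L + 1 < N + W ∧ N ≤ r * L + 1 := by
    have h1 := Nat.div_add_mod (N + W - 2) L
    have h2 := Nat.mod_lt (N + W - 2) hL
    rw [mul_comm] at h1
    exact ⟨(N + W - 2) / L, by omega, by omega⟩
  obtain ⟨u, hu, hy⟩ := hstep r hr
  obtain ⟨φ, hφ⟩ := (Complex.norm_eq_one_iff u).1 hu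
  refine ⟨φ, funext fun n => ?_⟩
  rw [hy n (by omega), Pi.smul_apply, smul_eq_mul, ← hφ, mul_comm (φ : ℂ)]

theorem ae_isGenericCoeff_sectionCoeff {N W : ℕ} (w : Fin W → ℂ) (L r a d : ℕ)
    (had : a + d < N) (hwin : IsSectionSupport N w L r a d) :
    ∀ᵐ x : Fin N → ℂ, IsGenericCoeff (sectionCoeff w L r a d had x) :=
  ae_isGenericCoeff_comp (e := fun i : Fin (d + 1) => (⟨a + i, by omega⟩ : Fin N))
    (fun i j hij => by simpa [Fin.val_inj] using hij)
    fun i => (hwin (a + i) (by omega)).2 ⟨by omega, by omega⟩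

theorem theorem1 (N W L M : ℕ) (w : Fin W → ℂ) (hw : STFTPhase.NonVanishing w)
    (hL : 0 < L) (hLW : L < W) (hWN : 2 * W ≤ N) (hWM : 2 * W ≤ M) (hMN : M ≤ N) :
    MeasureTheory.volume {x : Fin N → ℂ | STFTPhase.NonVanishing x ∧
      ¬ STFTPhase.UniquelyIdentified w L M x} = 0 := by
  have hgen : ∀ᵐ x : Fin N → ℂ, ∀ (r a d : ℕ) (had : a + d < N),
      IsSectionSupport N w L r a d →
      IsGenericCoeff (sectionCoeff w L r a d had x) := by
    simp only [ae_all_iff]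
    exact fun r a d had hwin => ae_isGenericCoeff_sectionCoeff w L r a d had hwin
  refine measure_eq_zero_iff_ae_notMem.2 (hgen.mono fun x hx' hx => hx.2 ?_)
  exact uniquelyIdentified_of_generic hw hL hLW (by omega) hWM hMN hx.1 hx'
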